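/- Let $I$ be a non-empty finite set, let $\{\alpha_i\mid i\in I\}$ be the standard basis of $\mathbb{Z}^I$, and let $\mathbb{N}_0$ be the set of non-negative integers. A generalized Cartan matrix is a matrix $(c_{ij})_{i,j\in I}\in\mathbb{Z}^{I\times I}$ with $c_{ii}=2$ for all $i$, $c_{jk}\le 0$ for $j\ne k$, and $c_{ij}=0\Rightarrow c_{ji}=0$. A Cartan scheme $\mathcal{C}=\mathcal{C}(I,A,(\rho_i)_{i\in I},(C^a)_{a\in A})$ consists of a non-empty set $A$ (of objects), maps $\rho_i:A\to A$ with $\rho_i^2=\mathrm{id}$ for $i\in I$, and generalized Cartan matrices $C^a=(c^a_{ij})_{i,j\in I}$ for $a\in A$ such that $c^{\rho_i(a)}_{ij}=c^a_{ij}$ for all $i,j\in I$, $a\in A$. It is connected if the group generated by the $\rho_i$ acts transitively on $A$. Let $\sigma_i^a\in\mathrm{Aut}(\mathbb{Z}^I)$ be given by $\sigma_i^a(\alpha_j)=\alpha_j-c^a_{ij}\alpha_i$ for all $j\in I$. A family $\mathcal{R}=(R^a)_{a\in A}$ of subsets of $\mathbb{Z}^I$ is a root system of type $\mathcal{C}$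 if - (R1) $R^a=R^a_+\cup -R^a_+$ with $R^a_+=R^a\cap\mathbb{N}_0^I$, for all $a\in A$; - (R2) $R^a\cap\mathbb{Z}\alpha_i=\{\alpha_i,-\alpha_i\}$ for all $i\in I$, $a\in A$; - (R3) $\sigma_i^a(R^a)=R^{\rho_i(a)}$ for all $i\in I$, $a\in A$; - (R4) if $i\ne j$ and $m^a_{i,j}:=|R^a\cap(\mathbb{N}_0\alpha_i+\mathbb{N}_0\alpha_j)|$ is finite, then $(\rho_i\rho_j)^{m^a_{i,j}}(a)=a$, for all $i,j\in I$, $a\in A$. It is finite if every $R^a$ is finite. For non-empty $J\subseteq I$, the restriction $\mathcal{R}|_J$ is the family of the sets $R^a\cap\sum_{i\in J}\mathbb{Z}\alpha_i$, regarded as subsets of $\mathbb{Z}^J$. If $I$ is the disjoint union of the non-empty subsets $I'$ and $I''$, then $\mathcal{R}$ is the direct sum $\mathcal{R}|_{I'}\oplus\mathcal{R}|_{I''}$ if for every $a\in A$ the set $R^a$ is the union of the root sets of $\mathcal{R}|_{I'}$ and $\mathcal{R}|_{I''}$ at $a$. **Proposition.** Let $\mathcal{C}$ be a connected Cartan scheme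 and $\mathcal{R}=(R^a)_{a\in A}$ a root system of type $\mathcal{C}$. Let $I'\subseteq I$ and $I''=I\setminus I'$, and assume that $I'$ and $I''$ are non-empty. For $a\in A$ let $$\hat R^a=\Big(R^a\cap\sum_{i\in I'}\mathbb{Z}\alpha_i\Big)\cup\Big(R^a\cap\sum_{i\in I''}\mathbb{Z}\alpha_i\Big).$$ The following are equivalent. 1. There exists $a\in A$ such that $c^a_{ij}=0$ for all $i\in I'$ and $j\in I''$. 2. For all $a\in A$, $i\in I'$ and $j\in I''$ one has $c^a_{ij}=c^a_{ji}=0$. 3. $\hat{\mathcal{R}}=(\hat R^a)_{a\in A}$ is a root system of type $\mathcal{C}$. If $\mathcal{R}$ is finite, then (1)–(3) are also equivalent to each of the following. 4. $\hat{\mathcal{R}}=\mathcal{R}$. 5. $\mathcal{R}=\mathcal{R}|_{I'}\oplus\mathcal{R}|_{I''}$. -/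

import Mathlib

open scoped Pointwise

/-- A generalized Cartan matrix in `ℤ^{I × I}`. -/
structure IsGeneralizedCartanMatrix {I : Type*} (c : Matrix I I ℤ) : Prop where
  diag : ∀ i, c i i = 2
  offDiag_nonpos : ∀ j k, j ≠ k → c j k ≤ 0
  zero_symm : ∀ i j, c i j = 0 → c j i = 0

/-- A Cartan scheme with (non-empty, finite) index set `I` and (non-empty) set of objects `A`. -/
structure CartanScheme (I A : Type*) where
  finite_index : Finite I
  nonempty_index : Nonempty I
  nonempty_obj : Nonempty A
  /-- the object changes -/
  rho : I → A → A
  /-- the Cartan matrices -/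
  cartan : A → Matrix I I ℤ
  isCartan : ∀ a, IsGeneralizedCartanMatrix (cartan a)
  rho_rho : ∀ i a, rho i (rho i a) = a
  cartan_rho : ∀ i j a, cartan (rho i a) i j = cartan a i j

/-- The standard basis vector of `ℤ^I` with index `i`. -/
def alpha {I : Type*} [DecidableEq I] (i : I) : I → ℤ := Pi.single i 1

/-- The subgroup of `ℤ^I` generated by the basis vectors with index in `J`. -/
def rootSpan {I : Type*} [DecidableEq I] (J : Finset I) : Submodule ℤ (I → ℤ) :=
  Submodule.span ℤ (alpha '' (J : Set I))

/-- The identification of `ℤ^J` with the subgroup of `ℤ^I` generated by the basis vectors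
with index in `J`: extension of coordinates by zero. -/
def extendRoot {I : Type*} [DecidableEq I] (J : Finset I) : (J → ℤ) →ₗ[ℤ] (I → ℤ) where
  toFun v i := if h : i ∈ J then v ⟨i, h⟩ else 0
  map_add' v w := by
    funext i
    by_cases h : i ∈ J <;> simp [h]
  map_smul' r v := by
    funext i
    by_cases h : i ∈ J <;> simp [h]

theorem extendRoot_apply {I : Type*} [DecidableEq I] (J : Finset I) (v : J → ℤ) (i : I) :
    extendRoot J v i = if h : i ∈ J then v ⟨i, h⟩ else 0 := rfl

theorem extendRoot_alpha {I : Type*} [DecidableEq I] (J : Finset I) (i : J) :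
    extendRoot J (alpha i) = alpha (i : I) := by
  funext k
  by_cases h : k ∈ J
  · simp [extendRoot_apply, alpha, h, Pi.single_apply, Subtype.ext_iff]
  · have : k ≠ i := fun e => h (e ▸ i.2)
    simp [extendRoot_apply, alpha, h, this]

theorem extendRoot_injective {I : Type*} [DecidableEq I] (J : Finset I) :
    Function.Injective (extendRoot J) := by
  intro v w h
  funext i
  have := congrFun h i
  simpa [extendRoot_apply] using this

theorem mem_rootSpan {I : Type*} [Fintype I] [DecidableEq I] (J : Finset I) (v : I → ℤ) :
    v ∈ rootSpan J ↔ ∀ i, i ∉ J → v i = 0 := by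
  constructor
  · intro hv i hi
    unfold rootSpan at hv
    induction hv using Submodule.span_induction with
    | mem x hx =>
      obtain ⟨j, hj, rfl⟩ := hx
      have : i ≠ j := fun e => hi (e ▸ hj)
      simp [alpha, this]
    | zero => rfl
    | add x y _ _ hx hy => simp [hx, hy]
    | smul r x _ hx => simp [hx]
  · intro hv
    have : v = ∑ i, v i • alpha i := by
      funext k
      simp [alpha, Finset.sum_apply, Pi.single_apply]
    rw [this]
    refine Submodule.sum_mem _ fun i _ => ?_
    by_cases hi : i ∈ J
    · exact Submodule.smul_mem _ _ (Submodule.subset_span ⟨i, hi, rfl⟩)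
    · simp [hv i hi]

/-- The image of `ℤ^J` in `ℤ^I` is the subgroup generated by the basis vectors in `J`. -/
theorem range_extendRoot {I : Type*} [Fintype I] [DecidableEq I] (J : Finset I) :
    Set.range (extendRoot J) = (rootSpan J : Set (I → ℤ)) := by
  ext v
  rw [SetLike.mem_coe, mem_rootSpan]
  constructor
  · rintro ⟨w, rfl⟩ i hi
    simp [extendRoot_apply, hi]
  · intro hv
    refine ⟨fun i => v i, ?_⟩
    funext i
    by_cases h : i ∈ J
    · simp [extendRoot_apply, h]
    · simp [extendRoot_apply, h, hv i h]

/-- The set `R ∩ (ℕ₀ α_i + ℕ₀ α_j)`, whose cardinality is the number `m_{i,j}`. -/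
def pairRoots {I : Type*} [DecidableEq I] (R : Set (I → ℤ)) (i j : I) : Set (I → ℤ) :=
  R ∩ {v | ∃ r s : ℕ, v = r • alpha i + s • alpha j}

/-- The split root sets
`(R^a ∩ ∑_{i ∈ J} ℤ α_i) ∪ (R^a ∩ ∑_{i ∈ I ∖ J} ℤ α_i)`. -/
def splitRoots {I A : Type*} [Fintype I] [DecidableEq I] (R : A → Set (I → ℤ))
    (J : Finset I) (a : A) : Set (I → ℤ) :=
  (R a ∩ rootSpan J) ∪ (R a ∩ rootSpan Jᶜ)

/-- The restriction to `J` of a family of root sets: the elements of `R^a ∩ ∑_{i ∈ J} ℤ α_i`,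
considered as elements of `ℤ^J`. -/
def restrictRoots {I A : Type*} [DecidableEq I] (R : A → Set (I → ℤ))
    (J : Finset I) (a : A) : Set (J → ℤ) :=
  {v | extendRoot J v ∈ R a}

theorem image_restrictRoots {I A : Type*} [Fintype I] [DecidableEq I] (R : A → Set (I → ℤ))
    (J : Finset I) (a : A) :
    extendRoot J '' restrictRoots R J a = R a ∩ rootSpan J := by
  rw [← range_extendRoot]
  ext v
  constructor
  · rintro ⟨w, hw, rfl⟩
    exact ⟨hw, w, rfl⟩
  · rintro ⟨hv, w, rfl⟩
    exact ⟨w, hv, rfl⟩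

/-- The family `R` is the direct sum of its restrictions to the non-empty sets `J` and `K`
which partition `I`: for every object, `R^a` is the union of the root sets of the two
restrictions (under the identification of `ℤ^J`, `ℤ^K` with subgroups of `ℤ^I`). -/
structure IsDirectSumOfRestrictions {I A : Type*} [Fintype I] [DecidableEq I]
    (R : A → Set (I → ℤ)) (J K : Finset I) : Prop where
  nonempty_left : J.Nonempty
  nonempty_right : K.Nonempty
  disjoint : Disjoint J K
  cover : J ∪ K = Finset.univ
  roots_eq : ∀ a, R a =
    (extendRoot J '' restrictRoots R J a) ∪ (extendRoot K '' restrictRoots R K a)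

namespace CartanScheme

/-- Any two objects are joined by a chain of object changes. -/
def IsConnected {I A : Type*} (C : CartanScheme I A) : Prop :=
  ∀ a b : A, Relation.ReflTransGen (fun x y => ∃ i, y = C.rho i x) a b

/-- The reflection `σ_i^a`, the endomorphism of `ℤ^I` with
`σ_i^a (α_j) = α_j - c^a_{ij} α_i` for all `j`. -/
def reflection {I A : Type*} [Fintype I] [DecidableEq I] (C : CartanScheme I A)
    (i : I) (a : A) : (I → ℤ) →ₗ[ℤ] (I → ℤ) where
  toFun v := v - (∑ j, v j * C.cartan a i j) • alpha i
  map_add' v w := by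
    simp only [Pi.add_apply, add_mul, Finset.sum_add_distrib, add_smul]
    abel
  map_smul' r v := by
    simp only [Pi.smul_apply, smul_eq_mul, mul_assoc, ← Finset.mul_sum, mul_smul, smul_sub,
      RingHom.id_apply]

theorem reflection_apply {I A : Type*} [Fintype I] [DecidableEq I] (C : CartanScheme I A)
    (i : I) (a : A) (v : I → ℤ) :
    C.reflection i a v = v - (∑ j, v j * C.cartan a i j) • alpha i := rfl

theorem reflection_alpha {I A : Type*} [Fintype I] [DecidableEq I] (C : CartanScheme I A)
    (i j : I) (a : A) :
    C.reflection i a (alpha j) = alpha j - C.cartan a i j • alpha i := by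
  simp [reflection_apply, alpha, Pi.single_apply]

/-- The family `(R^a)_{a ∈ A}` of subsets of `ℤ^I` is a root system of type `C`. -/
structure IsRootSystem {I A : Type*} [Fintype I] [DecidableEq I] (C : CartanScheme I A)
    (R : A → Set (I → ℤ)) : Prop where
  pos_neg : ∀ a, R a = (R a ∩ {v | 0 ≤ v}) ∪ -(R a ∩ {v | 0 ≤ v})
  multiples : ∀ i a, R a ∩ (Submodule.span ℤ {alpha i} : Submodule ℤ (I → ℤ)) =
    {alpha i, -alpha i}
  reflection_image : ∀ i a, C.reflection i a '' R a = R (C.rho i a)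
  coxeter : ∀ i j a, i ≠ j → (pairRoots (R a) i j).Finite →
    (C.rho i ∘ C.rho j)^[(pairRoots (R a) i j).ncard] a = a

/-- The restriction of a Cartan scheme to a non-empty subset `J` of the index set. -/
def restrict {I A : Type*} (C : CartanScheme I A) (J : Finset I) (hJ : J.Nonempty) :
    CartanScheme J A where
  finite_index := inferInstance
  nonempty_index := hJ.to_subtype
  nonempty_obj := C.nonempty_obj
  rho i := C.rho i
  cartan a := Matrix.of fun i j => C.cartan a i j
  isCartan a :=
    { diag := fun i => (C.isCartan a).diag i
      offDiag_nonpos := fun j k h =>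
        (C.isCartan a).offDiag_nonpos j k (fun e => h (Subtype.ext e))
      zero_symm := fun i j => (C.isCartan a).zero_symm i j }
  rho_rho i := C.rho_rho i
  cartan_rho i j a := C.cartan_rho i j a

theorem extendRoot_reflection {I A : Type*} [Fintype I] [DecidableEq I] (C : CartanScheme I A)
    (J : Finset I) (hJ : J.Nonempty) (i : J) (a : A) (v : J → ℤ) :
    extendRoot J ((C.restrict J hJ).reflection i a v) =
      C.reflection (i : I) a (extendRoot J v) := by
  rw [reflection_apply, reflection_apply, map_sub, map_smul, extendRoot_alpha]
  congr 2
  have h1 : ∑ j, extendRoot J v j * C.cartan a i j =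
      ∑ j ∈ J, extendRoot J v j * C.cartan a i j :=
    (Finset.sum_subset (Finset.subset_univ J)
      (fun k _ hk => by simp [extendRoot_apply, hk])).symm
  rw [h1, ← Finset.sum_coe_sort J]
  exact Finset.sum_congr rfl fun k _ => by simp [extendRoot_apply, restrict]

/-- The restriction of a root system of type `C` is a root system of type `C|_J`. -/
theorem IsRootSystem.restrict {I A : Type*} [Fintype I] [DecidableEq I] {C : CartanScheme I A}
    {R : A → Set (I → ℤ)} (hR : C.IsRootSystem R) (J : Finset I) (hJ : J.Nonempty) :
    (C.restrict J hJ).IsRootSystem (restrictRoots R J) := by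
  have hpos : ∀ v : J → ℤ, 0 ≤ extendRoot J v ↔ 0 ≤ v := by
    intro v
    constructor
    · intro h i
      have := h i
      simpa [extendRoot_apply] using this
    · intro h i
      by_cases hi : i ∈ J
      · simpa [extendRoot_apply, hi] using h ⟨i, hi⟩
      · simp [extendRoot_apply, hi]
  have hrefl := fun i a v => extendRoot_reflection C J hJ i a v
  constructor
  · intro a
    ext v
    have h := Set.ext_iff.1 (hR.pos_neg a) (extendRoot J v)
    simp only [Set.mem_union, Set.mem_inter_iff, Set.mem_ofPred_eq, Set.mem_neg, ← map_neg, hpos]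
      at h
    exact h
  · intro i a
    ext v
    have h := Set.ext_iff.1 (hR.multiples i a) (extendRoot J v)
    simp only [Set.mem_inter_iff, SetLike.mem_coe, Submodule.mem_span_singleton,
      Set.mem_insert_iff, Set.mem_singleton_iff, ← extendRoot_alpha, ← map_neg, ← map_smul,
      (extendRoot_injective J).eq_iff] at h
    simp only [Set.mem_inter_iff, SetLike.mem_coe, Submodule.mem_span_singleton,
      Set.mem_insert_iff, Set.mem_singleton_iff]
    exact h
  · intro i a
    have key : ∀ b v, v ∈ restrictRoots R J b →
        (C.restrict J hJ).reflection i b v ∈ restrictRoots R J (C.rho i b) := by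
      intro b v hv
      change extendRoot J _ ∈ R _
      rw [hrefl, ← hR.reflection_image]
      exact ⟨_, hv, rfl⟩
    apply Set.Subset.antisymm
    · rintro _ ⟨v, hv, rfl⟩
      exact key a v hv
    · intro v hv
      refine ⟨(C.restrict J hJ).reflection i (C.rho i a) v, ?_, ?_⟩
      · have := key (C.rho i a) v hv
        rwa [C.rho_rho] at this
      · apply extendRoot_injective J
        rw [hrefl, hrefl]
        have hc : ∀ j, C.cartan (C.rho i a) i j = C.cartan a i j :=
          fun j => C.cartan_rho i j a
        have hd := (C.isCartan a).diag i
        have e : C.reflection (i : I) (C.rho i a) (extendRoot J v) =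
            C.reflection (i : I) a (extendRoot J v) := by
          simp only [reflection_apply, hc]
        rw [e, C.reflection_apply i a (extendRoot J v), map_sub, map_smul, reflection_alpha, hd,
          C.reflection_apply i a (extendRoot J v)]
        module
  · intro i j a hij
    have him : extendRoot J '' pairRoots (restrictRoots R J a) i j = pairRoots (R a) i j := by
      ext v
      constructor
      · rintro ⟨w, ⟨hw, r, s, rfl⟩, rfl⟩
        exact ⟨hw, r, s, by
          rw [map_add, map_nsmul, map_nsmul, extendRoot_alpha, extendRoot_alpha]⟩
      · rintro ⟨hv, r, s, rfl⟩
        have e : extendRoot J (r • alpha i + s • alpha j) =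
            r • alpha (i : I) + s • alpha (j : I) := by
          rw [map_add, map_nsmul, map_nsmul, extendRoot_alpha, extendRoot_alpha]
        refine ⟨_, ⟨?_, r, s, rfl⟩, e⟩
        change extendRoot J _ ∈ R a
        rw [e]
        exact hv
    have h := hR.coxeter i j a (fun e => hij (Subtype.ext e))
    rw [← him, Set.ncard_image_of_injective _ (extendRoot_injective J)] at h
    intro hfin
    exact h (hfin.image _)

end CartanScheme

/-!
The conditions compare the Cartan entries linking `J = I'` and its complement with the mixed roots,
those with non-zero coordinates on both sides.

*Propagation.* If `c^a_{jk} = 0` for every `k ≠ j` in the support of a root `v ∈ R^a` with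
`v_j > 0`, then `σ_j^a` merely changes the sign of the `j`-th coordinate of `v`. As the image is a
root, its coordinates have a common sign, and `v = α_j` follows (`IsRootSystem.eq_zero_of_cartan`).
Moreover `α_j - c^a_{ij} α_i` is always a root at `a`. Applied to `σ_k^b (α_j - c^b_{ij} α_i)` with
`i, k ∈ J` and `j ∉ J`, and with the sides exchanged, the first fact shows that the vanishing of the
linking Cartan entries passes from `a` to `b = ρ_k(a)` (`IsRootSystem.splitsAt_rho`), hence to all
objects by connectedness. It also shows that `m_{i,j} = 2` for `i ∈ J` and `j ∉ J`, so that
splitting the root sets does not change the Coxeter relations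
(`IsRootSystem.isRootSystem_splitRoots`). Conversely, if the split sets form a root system, then
`α_j - c^a_{ij} α_i` is not mixed, which forces `c^a_{ij} = 0`.

*Absence of mixed roots in the finite case.* As in a finite Weyl group, there is a longest element
for `J`: a linear automorphism `w` of `ℤ^I` which maps `R^a` onto some `R^b`, fixes `α_j` for
`j ∉ J`, preserves `∑_{i ∈ J} ℤ α_i` and sends every `α_i` with `i ∈ J` to a negative root
(`IsRootSystem.exists_longest`). It is found by maximizing the number of positive roots made
negative. If `v = v' + v''` were a positive mixed root, then `w v = w v' + v''` would be a root with
`w v' < 0` and `v'' > 0`, supported on complementary sets; this contradicts the sign condition.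
-/

/-! ### Coordinates and reflections -/

theorem mem_span_alpha {I : Type*} [DecidableEq I] (i : I) (v : I → ℤ) :
    v ∈ Submodule.span ℤ {alpha i} ↔ ∀ k, k ≠ i → v k = 0 := by
  rw [Submodule.mem_span_singleton]
  constructor
  · rintro ⟨r, rfl⟩ k hk
    simp [alpha, hk]
  · intro h
    refine ⟨v i, ?_⟩
    funext k
    by_cases hk : k = i
    · subst hk; simp [alpha]
    · simp [alpha, hk, h k hk]

theorem alpha_nonneg {I : Type*} [DecidableEq I] (i : I) : (0 : I → ℤ) ≤ alpha i := by
  intro k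
  by_cases hk : k = i
  · subst hk; simp [alpha]
  · simp [alpha, hk]

theorem alpha_ne_zero {I : Type*} [DecidableEq I] (i : I) : alpha i ≠ (0 : I → ℤ) := by
  intro h
  simpa [alpha] using congrFun h i

namespace CartanScheme

variable {I A : Type*} [Fintype I] [DecidableEq I] {C : CartanScheme I A}
  {R : A → Set (I → ℤ)}

theorem reflection_apply_of_ne (C : CartanScheme I A) {i k : I} (hk : k ≠ i) (a : A)
    (v : I → ℤ) : C.reflection i a v k = v k := by
  simp [reflection_apply, alpha, hk]

theorem reflection_rho (C : CartanScheme I A) (i : I) (a : A) :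
    C.reflection i (C.rho i a) = C.reflection i a := by
  refine LinearMap.ext fun v => ?_
  simp only [reflection_apply, C.cartan_rho]

theorem reflection_alpha_self (C : CartanScheme I A) (i : I) (a : A) :
    C.reflection i a (alpha i) = -alpha i := by
  rw [reflection_alpha, (C.isCartan a).diag i]
  module

theorem reflection_involutive (C : CartanScheme I A) (i : I) (a : A) :
    Function.Involutive (C.reflection i a) := by
  intro v
  rw [C.reflection_apply i a v, map_sub, map_smul, reflection_alpha_self, reflection_apply]
  module

/-- If the support of `v` is orthogonal to `α_j` away from `j`, then `σ_j` only changes the sign of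
the `j`-th coordinate. -/
theorem reflection_apply_self_of_cartan (C : CartanScheme I A) {j : I} {a : A} {v : I → ℤ}
    (h : ∀ k, k ≠ j → v k ≠ 0 → C.cartan a j k = 0) : C.reflection j a v j = -v j := by
  have hs : ∑ k, v k * C.cartan a j k = v j * 2 := by
    rw [Finset.sum_eq_single j, (C.isCartan a).diag j]
    · intro k _ hk
      by_cases hv : v k = 0
      · simp [hv]
      · simp [h k hk hv]
    · simp
  rw [reflection_apply, hs]
  simp [alpha]
  ring

/-! ### Roots -/

namespace IsRootSystem

theorem neg_mem (hR : C.IsRootSystem R) {a : A} {v : I → ℤ} (hv : v ∈ R a) : -v ∈ R a := by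
  rw [hR.pos_neg a] at hv ⊢
  rcases hv with hv | hv
  · exact Or.inr (by simpa using hv)
  · exact Or.inl hv

theorem nonneg_or_nonpos (hR : C.IsRootSystem R) {a : A} {v : I → ℤ} (hv : v ∈ R a) :
    0 ≤ v ∨ v ≤ 0 := by
  rw [hR.pos_neg a] at hv
  rcases hv with hv | hv
  · exact Or.inl hv.2
  · exact Or.inr (neg_nonneg.1 hv.2)

theorem alpha_mem (hR : C.IsRootSystem R) (i : I) (a : A) : alpha i ∈ R a := by
  have h : alpha i ∈ ({alpha i, -alpha i} : Set (I → ℤ)) := Or.inl rfl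
  rw [← hR.multiples i a] at h
  exact h.1

theorem zero_notMem (hR : C.IsRootSystem R) (a : A) : (0 : I → ℤ) ∉ R a := by
  intro h
  obtain ⟨i⟩ := C.nonempty_index
  have h0 : (0 : I → ℤ) ∈ R a ∩ (Submodule.span ℤ {alpha i} : Submodule ℤ (I → ℤ)) :=
    ⟨h, Submodule.zero_mem _⟩
  rw [hR.multiples i a] at h0
  rcases h0 with h0 | h0
  · exact alpha_ne_zero i h0.symm
  · exact alpha_ne_zero i (neg_eq_zero.1 h0.symm)

theorem eq_alpha_or_eq_neg_alpha (hR : C.IsRootSystem R) {a : A} {i : I} {v : I → ℤ}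
    (hv : v ∈ R a) (h : ∀ k, k ≠ i → v k = 0) : v = alpha i ∨ v = -alpha i := by
  have hm : v ∈ R a ∩ (Submodule.span ℤ {alpha i} : Submodule ℤ (I → ℤ)) :=
    ⟨hv, (mem_span_alpha i v).2 h⟩
  rw [hR.multiples i a] at hm
  exact hm

theorem reflection_mem (hR : C.IsRootSystem R) {a : A} {v : I → ℤ} (i : I) (hv : v ∈ R a) :
    C.reflection i a v ∈ R (C.rho i a) := by
  rw [← hR.reflection_image]
  exact ⟨v, hv, rfl⟩

/-- The element `α_j - c_{ij} α_i` is the image of `α_j` under the reflection which arrives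
at `a`. -/
theorem alpha_sub_mem (hR : C.IsRootSystem R) (i j : I) (a : A) :
    alpha j - C.cartan a i j • alpha i ∈ R a := by
  have h := hR.reflection_mem i (hR.alpha_mem j (C.rho i a))
  rwa [reflection_rho, reflection_alpha, C.rho_rho] at h

/-- If a root is positive at `j` and the rest of its support is orthogonal to `α_j`, then it has no
further support: otherwise `σ_j` would turn it into a root with coordinates of both signs. -/
theorem eq_zero_of_cartan (hR : C.IsRootSystem R) {a : A} {j : I} {v : I → ℤ} (hv : v ∈ R a)
    (hj : 0 < v j) (h : ∀ k, k ≠ j → v k ≠ 0 → C.cartan a j k = 0) {k : I} (hk : k ≠ j) :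
    v k = 0 := by
  have h1 := C.reflection_apply_self_of_cartan h
  have h2 := C.reflection_apply_of_ne hk a v
  have hpos : 0 ≤ v := by
    refine (hR.nonneg_or_nonpos hv).resolve_right fun hle => ?_
    have : v j ≤ 0 := hle j
    omega
  have hneg : C.reflection j a v ≤ 0 := by
    refine (hR.nonneg_or_nonpos (hR.reflection_mem j hv)).resolve_left fun hle => ?_
    have : 0 ≤ C.reflection j a v j := hle j
    omega
  have h3 : 0 ≤ v k := hpos k
  have h4 : C.reflection j a v k ≤ 0 := hneg k
  omega

/-- A reflection `σ_i` makes no positive root negative except `α_i`. -/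
theorem eq_alpha_of_reflection_nonpos (hR : C.IsRootSystem R) {a : A} {i : I} {v : I → ℤ}
    (hv : v ∈ R a) (hpos : 0 ≤ v) (hneg : C.reflection i a v ≤ 0) : v = alpha i := by
  have h0 : ∀ k, k ≠ i → v k = 0 := fun k hk => by
    have h1 : C.reflection i a v k ≤ 0 := hneg k
    rw [C.reflection_apply_of_ne hk] at h1
    exact le_antisymm h1 (hpos k)
  refine (hR.eq_alpha_or_eq_neg_alpha hv h0).resolve_right fun h => ?_
  have := hpos i
  simp [h, alpha] at this

theorem pairRoots_eq_of_cartan (hR : C.IsRootSystem R) {a : A} {i j : I} (hij : i ≠ j)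
    (h : C.cartan a j i = 0) : pairRoots (R a) i j = {alpha i, alpha j} := by
  ext v
  constructor
  · rintro ⟨hv, r, s, rfl⟩
    have hpos : 0 ≤ r • alpha i + s • alpha j :=
      add_nonneg (nsmul_nonneg (alpha_nonneg i) r) (nsmul_nonneg (alpha_nonneg j) s)
    have hout : ∀ k, k ≠ i → k ≠ j → (r • alpha i + s • alpha j) k = 0 := by
      intro k hki hkj
      simp [alpha, hki, hkj]
    have hsj : (r • alpha i + s • alpha j) j = s := by
      simp [alpha, hij.symm]
    have key : ∀ l, (∀ k, k ≠ l → (r • alpha i + s • alpha j) k = 0) →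
        r • alpha i + s • alpha j = alpha l := by
      intro l hl
      refine (hR.eq_alpha_or_eq_neg_alpha hv hl).resolve_right fun e => ?_
      have := hpos l
      rw [e] at this
      simp [alpha] at this
    by_cases hs : s = 0
    · refine Or.inl (key i fun k hk => ?_)
      by_cases hkj : k = j
      · subst hkj; rw [hsj, hs]; rfl
      · exact hout k hk hkj
    · refine Or.inr (key j fun k hk => ?_)
      refine hR.eq_zero_of_cartan hv (by rw [hsj]; omega) (fun l hl hl0 => ?_) hk
      by_cases hli : l = i
      · rw [hli, h]
      · exact absurd (hout l hli hl) hl0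
  · rintro (rfl | rfl)
    · exact ⟨hR.alpha_mem i a, 1, 0, by simp⟩
    · exact ⟨hR.alpha_mem j a, 0, 1, by simp⟩

end IsRootSystem

/-! ### Propagation of a splitting of the Cartan matrix -/

/-- The Cartan matrix at `a` is block diagonal with respect to `J` and its complement. -/
def SplitsAt (C : CartanScheme I A) (J : Finset I) (a : A) : Prop :=
  ∀ i ∈ J, ∀ j ∈ Jᶜ, C.cartan a i j = 0 ∧ C.cartan a j i = 0

theorem SplitsAt.compl {J : Finset I} {a : A} (h : C.SplitsAt J a) : C.SplitsAt Jᶜ a :=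
  fun i hi j hj => (h j (by simpa using hj) i hi).symm

theorem splitsAt_of_cartan {J : Finset I} {a : A}
    (h : ∀ i ∈ J, ∀ j ∈ Jᶜ, C.cartan a i j = 0) : C.SplitsAt J a :=
  fun i hi j hj => ⟨h i hi j hj, (C.isCartan a).zero_symm i j (h i hi j hj)⟩

theorem IsRootSystem.splitsAt_rho_of_mem (hR : C.IsRootSystem R) {J : Finset I} {a : A}
    (h : C.SplitsAt J a) {k : I} (hk : k ∈ J) : C.SplitsAt J (C.rho k a) := by
  refine splitsAt_of_cartan fun i hi j hj => ?_
  by_cases hik : i = k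
  · subst hik
    rw [C.cartan_rho]
    exact (h i hi j hj).1
  have hjJ : j ∉ J := by simpa using hj
  have hij : i ≠ j := fun e => hjJ (e ▸ hi)
  have hkj : j ≠ k := fun e => hjJ (e ▸ hk)
  -- Reflecting back to `a` changes the coordinate at `k` only, and `k ≠ i, j`.
  have hm := hR.reflection_mem k (hR.alpha_sub_mem i j (C.rho k a))
  rw [C.rho_rho] at hm
  set v := C.reflection k (C.rho k a) (alpha j - C.cartan (C.rho k a) i j • alpha i) with hv
  have hvne : ∀ l, l ≠ k → v l = (alpha j - C.cartan (C.rho k a) i j • alpha i) l :=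
    fun l hl => C.reflection_apply_of_ne hl _ _
  have hvj : v j = 1 := by
    rw [hvne j hkj]
    simp [alpha, hij.symm]
  have hvi : v i = -C.cartan (C.rho k a) i j := by
    rw [hvne i hik]
    simp [alpha, hij]
  have hvi0 : v i = 0 := by
    refine hR.eq_zero_of_cartan hm (by omega) (fun l hl hl0 => ?_) hij
    by_cases hlJ : l ∈ J
    · exact (h l hlJ j hj).2
    · refine absurd ?_ hl0
      have hlk : l ≠ k := fun e => hlJ (e ▸ hk)
      have hli : l ≠ i := fun e => hlJ (e ▸ hi)
      rw [hvne l hlk]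
      simp [alpha, hl, hli]
  omega

theorem IsRootSystem.splitsAt_rho (hR : C.IsRootSystem R) {J : Finset I} {a : A}
    (h : C.SplitsAt J a) (k : I) : C.SplitsAt J (C.rho k a) := by
  by_cases hk : k ∈ J
  · exact hR.splitsAt_rho_of_mem h hk
  · simpa using (hR.splitsAt_rho_of_mem h.compl (by simpa using hk)).compl

theorem IsRootSystem.splitsAt_of_isConnected (hR : C.IsRootSystem R) (hC : C.IsConnected)
    {J : Finset I} {a : A} (h : C.SplitsAt J a) (b : A) : C.SplitsAt J b := by
  induction hC a b with
  | refl => exact h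
  | tail _ hs ih =>
    obtain ⟨i, rfl⟩ := hs
    exact hR.splitsAt_rho ih i

/-! ### The split root sets -/

theorem mem_splitRoots {J : Finset I} {a : A} {v : I → ℤ} :
    v ∈ splitRoots R J a ↔
      v ∈ R a ∧ ((∀ k, k ∉ J → v k = 0) ∨ ∀ k, k ∈ J → v k = 0) := by
  simp [splitRoots, mem_rootSpan, and_or_left]

theorem SplitsAt.reflection_apply_eq_zero {J : Finset I} {a : A} (h : C.SplitsAt J a) {v : I → ℤ}
    (hv : ∀ k, k ∉ J → v k = 0) (i : I) {k : I} (hk : k ∉ J) : C.reflection i a v k = 0 := by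
  by_cases hki : k = i
  · subst hki
    rw [C.reflection_apply_self_of_cartan fun l _ hl0 => ?_, hv k hk, neg_zero]
    have hlJ : l ∈ J := by_contra fun hlJ => hl0 (hv l hlJ)
    exact (h l hlJ k (by simpa using hk)).2
  · rw [C.reflection_apply_of_ne hki, hv k hk]

/-- Splitting the root sets along a decomposition of all Cartan matrices yields a root system. -/
theorem IsRootSystem.isRootSystem_splitRoots (hR : C.IsRootSystem R) {J : Finset I}
    (h : ∀ a, C.SplitsAt J a) : C.IsRootSystem (splitRoots R J) := by
  have hneg : ∀ a v, v ∈ splitRoots R J a → -v ∈ splitRoots R J a := by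
    intro a v hv
    rw [mem_splitRoots] at hv ⊢
    simpa using ⟨hR.neg_mem hv.1, hv.2⟩
  have hsub : ∀ a v, v ∈ splitRoots R J a → v ∈ R a := fun a v hv =>
    (mem_splitRoots.1 hv).1
  have halpha : ∀ i a, alpha i ∈ splitRoots R J a := by
    intro i a
    refine mem_splitRoots.2 ⟨hR.alpha_mem i a, ?_⟩
    by_cases hi : i ∈ J
    · refine Or.inl fun k hk => ?_
      have : k ≠ i := fun e => hk (e ▸ hi)
      simp [alpha, this]
    · refine Or.inr fun k hk => ?_
      have : k ≠ i := fun e => hi (e ▸ hk)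
      simp [alpha, this]
  have hrefl : ∀ i a v, v ∈ splitRoots R J a →
      C.reflection i a v ∈ splitRoots R J (C.rho i a) := by
    intro i a v hv
    rw [mem_splitRoots] at hv ⊢
    refine ⟨hR.reflection_mem i hv.1, hv.2.imp ?_ ?_⟩
    · exact fun hv k hk => (h a).reflection_apply_eq_zero hv i hk
    · exact fun hv k hk => (h a).compl.reflection_apply_eq_zero (by simpa using hv) i
        (by simpa using hk)
  constructor
  · intro a
    ext v
    constructor
    · intro hv
      rcases hR.nonneg_or_nonpos (hsub a v hv) with h0 | h0
      · exact Or.inl ⟨hv, h0⟩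
      · exact Or.inr ⟨hneg a v hv, neg_nonneg.2 h0⟩
    · rintro (hv | hv)
      · exact hv.1
      · simpa using hneg a _ hv.1
  · intro i a
    apply Set.Subset.antisymm
    · rw [← hR.multiples i a]
      exact Set.inter_subset_inter_left _ (hsub a)
    · rintro _ (rfl | rfl)
      · exact ⟨halpha i a, Submodule.mem_span_singleton_self _⟩
      · exact ⟨hneg a _ (halpha i a), Submodule.neg_mem _ (Submodule.mem_span_singleton_self _)⟩
  · intro i a
    apply Set.Subset.antisymm
    · rintro _ ⟨v, hv, rfl⟩
      exact hrefl i a v hv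
    · intro v hv
      refine ⟨C.reflection i a v, ?_, C.reflection_involutive i a v⟩
      have := hrefl i _ v hv
      rwa [reflection_rho, C.rho_rho] at this
  · intro i j a hij
    suffices hp : pairRoots (splitRoots R J a) i j = pairRoots (R a) i j by
      rw [hp]
      exact hR.coxeter i j a hij
    apply Set.Subset.antisymm (Set.inter_subset_inter_left _ (hsub a))
    intro v hv
    refine ⟨?_, hv.2⟩
    by_cases hc : C.cartan a j i = 0
    · change v ∈ pairRoots (R a) i j at hv
      rw [hR.pairRoots_eq_of_cartan hij hc] at hv
      rcases hv with rfl | rfl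
      · exact halpha i a
      · exact halpha j a
    -- If `i` and `j` are linked, then they lie on the same side, and so do their combinations.
    · obtain ⟨hv, r, s, rfl⟩ := hv
      refine mem_splitRoots.2 ⟨hv, ?_⟩
      by_cases hi : i ∈ J
      · have hj : j ∈ J := by_contra fun hj => hc (h a i hi j (by simpa using hj)).2
        refine Or.inl fun k hk => ?_
        have hki : k ≠ i := fun e => hk (e ▸ hi)
        have hkj : k ≠ j := fun e => hk (e ▸ hj)
        simp [alpha, hki, hkj]
      · have hj : j ∉ J := fun hj => hc (h a j hj i (by simpa using hi)).1
        refine Or.inr fun k hk => ?_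
        have hki : k ≠ i := fun e => hi (e ▸ hk)
        have hkj : k ≠ j := fun e => hj (e ▸ hk)
        simp [alpha, hki, hkj]

theorem splitsAt_of_isRootSystem_splitRoots {J : Finset I}
    (h : C.IsRootSystem (splitRoots R J)) (a : A) : C.SplitsAt J a := by
  refine splitsAt_of_cartan fun i hi j hj => ?_
  have hjJ : j ∉ J := by simpa using hj
  have hij : i ≠ j := fun e => hjJ (e ▸ hi)
  rcases (mem_splitRoots.1 (h.alpha_sub_mem i j a)).2 with h1 | h1
  · have := h1 j hjJ
    simp [alpha, hij.symm] at this
  · have := h1 i hi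
    simpa [alpha, hij] using this

/-! ### The longest element and mixed roots -/

/-- A linear automorphism behaving like a product of reflections with index in `J` which starts at
`a` and ends at `b`, in a Cartan scheme where `J` is separated from its complement: it maps roots to
roots, changes vectors by elements of `∑_{i ∈ J} ℤ α_i` and fixes `α_j` for `j ∉ J`. These
properties are all that is needed here, so no word in the reflections is recorded. -/
structure IsParabolic (R : A → Set (I → ℤ)) (J : Finset I) (a b : A)
    (w : (I → ℤ) ≃ₗ[ℤ] (I → ℤ)) : Prop where
  mem_iff : ∀ v, w v ∈ R b ↔ v ∈ R a
  apply_coord : ∀ v, ∀ k ∉ J, w v k = v k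
  apply_fixed : ∀ v : I → ℤ, (∀ k ∈ J, v k = 0) → w v = v

theorem IsParabolic.reflection (hR : C.IsRootSystem R) {J : Finset I} {a b : A}
    (hs : C.SplitsAt J b) {w : (I → ℤ) ≃ₗ[ℤ] (I → ℤ)} (hw : IsParabolic R J a b w) {i : I}
    (hi : i ∈ J) :
    IsParabolic R J a (C.rho i b)
      (w.trans (LinearEquiv.ofInvolutive (C.reflection i b) (C.reflection_involutive i b))) where
  mem_iff v := by
    rw [← hw.mem_iff]
    change C.reflection i b (w v) ∈ _ ↔ _
    refine ⟨fun hv => ?_, hR.reflection_mem i⟩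
    have := hR.reflection_mem i hv
    rwa [reflection_rho, C.reflection_involutive, C.rho_rho] at this
  apply_coord v k hk := by
    have hki : k ≠ i := fun e => hk (e ▸ hi)
    rw [← hw.apply_coord v k hk]
    exact C.reflection_apply_of_ne hki b (w v)
  apply_fixed v hv := by
    change C.reflection i b (w v) = v
    rw [hw.apply_fixed v hv, reflection_apply, Finset.sum_eq_zero, zero_smul, sub_zero]
    intro k _
    by_cases hk : k ∈ J
    · rw [hv k hk, zero_mul]
    · rw [(hs i hi k (by simpa using hk)).1, mul_zero]

/-- A longest element: some parabolic automorphism sends all `α_i` with `i ∈ J` to negative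
roots. -/
theorem IsRootSystem.exists_longest (hR : C.IsRootSystem R) {J : Finset I}
    (hs : ∀ a, C.SplitsAt J a) {a : A} (hfin : (R a).Finite) :
    ∃ b w, IsParabolic R J a b w ∧ ∀ i ∈ J, w (alpha i) ≤ 0 := by
  -- The inversion set; `w` is chosen so that its cardinality is maximal.
  let N : ((I → ℤ) ≃ₗ[ℤ] (I → ℤ)) → Set (I → ℤ) := fun w => {v | v ∈ R a ∧ 0 ≤ v ∧ w v ≤ 0}
  have hN : ∀ w, (N w).Finite := fun w => hfin.subset fun v hv => hv.1
  let S : Set ℕ := {n | ∃ b w, IsParabolic R J a b w ∧ (N w).ncard = n}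
  have hSne : S.Nonempty :=
    ⟨_, a, LinearEquiv.refl ℤ (I → ℤ), ⟨fun _ => Iff.rfl, fun _ _ _ => rfl, fun _ _ => rfl⟩, rfl⟩
  have hSbdd : BddAbove S := by
    refine ⟨(R a).ncard, ?_⟩
    rintro _ ⟨b, w, _, rfl⟩
    exact Set.ncard_le_ncard (fun v hv => hv.1) hfin
  obtain ⟨b, w, hw, hmax⟩ := Nat.sSup_mem hSne hSbdd
  have hinv : ∀ i ∈ J, w.symm (alpha i) ≤ 0 := by
    intro i hi
    have hroot : w.symm (alpha i) ∈ R a := by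
      rw [← hw.mem_iff, w.apply_symm_apply]
      exact hR.alpha_mem i b
    refine (hR.nonneg_or_nonpos hroot).resolve_left fun hpos => ?_
    have hw' := hw.reflection hR (hs b) hi
    set w' := w.trans
      (LinearEquiv.ofInvolutive (C.reflection i b) (C.reflection_involutive i b)) with hw'def
    have hw'app : ∀ v, w' v = C.reflection i b (w v) := fun _ => rfl
    -- Composing with `σ_i` keeps all inversions and adds the positive root `w⁻¹ α_i`.
    have hss : N w ⊂ N w' := by
      refine Set.ssubset_iff_of_subset ?_ |>.2 ⟨w.symm (alpha i), ⟨hroot, hpos, ?_⟩, ?_⟩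
      · rintro v ⟨hv, hv0, hwv⟩
        refine ⟨hv, hv0, ?_⟩
        refine (hR.nonneg_or_nonpos ((hw'.mem_iff v).2 hv)).resolve_left fun hle => ?_
        have he : -w v = alpha i := by
          refine hR.eq_alpha_of_reflection_nonpos (hR.neg_mem ((hw.mem_iff v).2 hv))
            (neg_nonneg.2 hwv) ?_
          rw [map_neg]
          exact neg_nonpos.2 hle
        rw [← he, map_neg, w.symm_apply_apply] at hpos
        have hv00 : v = 0 := le_antisymm (neg_nonneg.1 hpos) hv0
        exact hR.zero_notMem a (hv00 ▸ hv)
      · rw [hw'app, w.apply_symm_apply, reflection_alpha_self]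
        exact neg_nonpos.2 (alpha_nonneg i)
      · rintro ⟨-, -, h⟩
        rw [w.apply_symm_apply] at h
        exact alpha_ne_zero i (le_antisymm h (alpha_nonneg i))
    have h1 : (N w').ncard ≤ sSup S := le_csSup hSbdd ⟨_, _, hw', rfl⟩
    have h2 := Set.ncard_lt_ncard hss (hN w')
    omega
  refine ⟨b, w, hw, fun i hi => ?_⟩
  refine (hR.nonneg_or_nonpos ((hw.mem_iff _).2 (hR.alpha_mem i a))).resolve_left fun hpos => ?_
  -- A nonnegative `w α_i` would be a nonnegative combination of the `α_k`, `k ∈ J`, whose images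
  -- under `w⁻¹` are nonpositive.
  have hexp : w (alpha i) = ∑ k, w (alpha i) k • alpha k := by
    funext l
    simp [alpha, Finset.sum_apply, Pi.single_apply]
  have hle : alpha i ≤ 0 := by
    rw [← w.symm_apply_apply (alpha i), hexp, map_sum]
    refine Finset.sum_nonpos fun k _ => ?_
    rw [map_smul]
    by_cases hk : k ∈ J
    · exact smul_nonpos_of_nonneg_of_nonpos (hpos k) (hinv k hk)
    · have hki : k ≠ i := fun e => hk (e ▸ hi)
      rw [hw.apply_coord _ k hk]
      simp [alpha, hki]
  exact alpha_ne_zero i (le_antisymm hle (alpha_nonneg i))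

theorem IsRootSystem.eq_zero_or_eq_zero_of_nonneg (hR : C.IsRootSystem R) {J : Finset I}
    (hs : ∀ a, C.SplitsAt J a) {a : A} (hfin : (R a).Finite) {v : I → ℤ} (hv : v ∈ R a)
    (hpos : 0 ≤ v) : (∀ k, k ∉ J → v k = 0) ∨ ∀ k, k ∈ J → v k = 0 := by
  obtain ⟨b, w, hw, hneg⟩ := hR.exists_longest hs hfin
  by_contra! hcon
  obtain ⟨⟨j, hj, hvj⟩, k, hk, hvk⟩ := hcon
  let x : I → ℤ := fun l => if l ∈ J then v l else 0
  have hxv : ∀ l ∈ J, (v - x) l = 0 := fun l hl => by simp [x, hl]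
  have hwx : w x ≤ 0 := by
    have hexp : x = ∑ l, x l • alpha l := by
      funext m
      simp [alpha, Finset.sum_apply, Pi.single_apply]
    rw [hexp, map_sum]
    refine Finset.sum_nonpos fun l _ => ?_
    rw [map_smul]
    by_cases hl : l ∈ J
    · refine smul_nonpos_of_nonneg_of_nonpos ?_ (hneg l hl)
      simpa [x, hl] using hpos l
    · simp [x, hl]
  have hwv : ∀ l ∈ J, w v l = w x l := by
    intro l hl
    have h1 : w v = w x + (v - x) := by
      rw [← hw.apply_fixed _ hxv, ← map_add]
      congr 1
      abel
    rw [h1, Pi.add_apply, hxv l hl, add_zero]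
  rcases hR.nonneg_or_nonpos ((hw.mem_iff v).2 hv) with h0 | h0
  -- Here `w x` vanishes on `J` as well as outside, hence `x = 0`.
  · have hx0 : w x = 0 := by
      funext l
      by_cases hl : l ∈ J
      · exact le_antisymm (hwx l) (hwv l hl ▸ h0 l)
      · rw [hw.apply_coord x l hl]
        simp [x, hl]
    have hx := congrFun (w.map_eq_zero_iff.1 hx0) k
    exact hvk (by simpa [x, hk] using hx)
  · have h1 : w v j ≤ 0 := h0 j
    rw [hw.apply_coord v j hj] at h1
    exact hvj (le_antisymm h1 (hpos j))

theorem IsRootSystem.splitRoots_eq_self (hR : C.IsRootSystem R) {J : Finset I}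
    (hs : ∀ a, C.SplitsAt J a) (hfin : ∀ a, (R a).Finite) : splitRoots R J = R := by
  funext a
  ext v
  rw [mem_splitRoots, and_iff_left_iff_imp]
  intro hv
  rcases hR.nonneg_or_nonpos hv with h0 | h0
  · exact hR.eq_zero_or_eq_zero_of_nonneg hs (hfin a) hv h0
  · simpa using hR.eq_zero_or_eq_zero_of_nonneg hs (hfin a) (hR.neg_mem hv) (neg_nonneg.2 h0)

end CartanScheme

theorem isDirectSumOfRestrictions_iff {I A : Type*} [Fintype I] [DecidableEq I]
    {R : A → Set (I → ℤ)} {J : Finset I} (hJ : J.Nonempty) (hJc : Jᶜ.Nonempty) :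
    IsDirectSumOfRestrictions R J Jᶜ ↔ splitRoots R J = R := by
  have key : ∀ a, (extendRoot J '' restrictRoots R J a) ∪ (extendRoot Jᶜ '' restrictRoots R Jᶜ a) =
      splitRoots R J a := fun a => by
    rw [image_restrictRoots, image_restrictRoots, splitRoots]
  constructor
  · intro h
    funext a
    rw [← key, ← h.roots_eq]
  · intro h
    exact ⟨hJ, hJc, disjoint_compl_right, Finset.union_compl J, fun a => by rw [key, h]⟩

open CartanScheme in
theorem mainTheorem5 {I A : Type*} [Fintype I] [DecidableEq I]
    (C : CartanScheme I A) (hC : C.IsConnected)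
    (R : A → Set (I → ℤ)) (hR : C.IsRootSystem R)
    (I' I'' : Finset I) (hcompl : I'' = I'ᶜ) (hI' : I'.Nonempty) (hI'' : I''.Nonempty) :
    List.TFAE
      [ (∃ a, ∀ i ∈ I', ∀ j ∈ I'', C.cartan a i j = 0),
        (∀ a, ∀ i ∈ I', ∀ j ∈ I'', C.cartan a i j = 0 ∧ C.cartan a j i = 0),
        C.IsRootSystem (splitRoots R I') ] ∧
    ((∀ a, (R a).Finite) →
      List.TFAE
        [ (∃ a, ∀ i ∈ I', ∀ j ∈ I'', C.cartan a i j = 0),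
          (∀ a, ∀ i ∈ I', ∀ j ∈ I'', C.cartan a i j = 0 ∧ C.cartan a j i = 0),
          C.IsRootSystem (splitRoots R I'),
          splitRoots R I' = R,
          IsDirectSumOfRestrictions R I' I'' ]) := by
  subst hcompl
  have h12 : (∃ a, ∀ i ∈ I', ∀ j ∈ I'ᶜ, C.cartan a i j = 0) → ∀ a, C.SplitsAt I' a :=
    fun ⟨_, h⟩ => hR.splitsAt_of_isConnected hC (splitsAt_of_cartan h)
  have h23 : (∀ a, C.SplitsAt I' a) → C.IsRootSystem (splitRoots R I') := hR.isRootSystem_splitRoots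
  have h31 : C.IsRootSystem (splitRoots R I') →
      ∃ a, ∀ i ∈ I', ∀ j ∈ I'ᶜ, C.cartan a i j = 0 := fun h =>
    have ⟨a⟩ := C.nonempty_obj
    ⟨a, fun i hi j hj => (splitsAt_of_isRootSystem_splitRoots h a i hi j hj).1⟩
  refine ⟨?_, fun hfin => ?_⟩
  · tfae_have 1 → 2 := h12
    tfae_have 2 → 3 := h23
    tfae_have 3 → 1 := h31
    tfae_finish
  · tfae_have 1 → 2 := h12
    tfae_have 2 → 3 := h23
    tfae_have 3 → 1 := h31
    tfae_have 2 → 4 := fun h => hR.splitRoots_eq_self h hfin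
    tfae_have 4 → 3 := fun h => by rwa [h]
    tfae_have 5 ↔ 4 := isDirectSumOfRestrictions_iff hI' hI''
    tfae_finish
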